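/- Fix integers $d\ge 1$ and $D,\kappa,R,K\ge 0$, reals $h$, $\delta>0$, $\beta_c$, a function $c:\mathbb R\to\mathbb R$ and $\beta\in[0,\beta_c)$. Then there are constants $C,\xi>0$, depending only on these data, such that the following holds for every finite set of sites $\Lambda\subset\mathbb Z^D$, $n=|\Lambda|$, with a $d$-dimensional qudit on each site, and every Hamiltonian $H=\sum_{X\subseteq\Lambda}H_X$ whose terms are Hermitian, mutually commuting, supported on $X$, with operator norm $\|H_X\|\le h$, and with $H_X=0$ whenever $\mathrm{diam}(X)>R$ or $|X|>\kappa$ (distances are lattice, i.e. $\ell^1$, distances). Suppose that for every $\beta'\in[0,\beta_c)$, every operator $N\ge 0$ with $\|N\|=1$ supported on at most $K$ sites, and every tuple $(z_X)_{X\subseteq\Lambda}$ of complex numbers with $|z_X-\beta'|\le\delta$ for all $X$, $$\mathrm{Tr}\Big[e^{-\sum_X z_XH_X}N\Big]\ne 0\qquad\text{and}\qquad \Big|\log \mathrm{Tr}\Big[e^{-\sum_X z_XH_X}N\Big]\Big|\le c(\beta')\,n ,$$ where $\log$ is the principal logarithm. Then, with $\rho_\beta(H)=e^{-\beta H}/\mathrm{Tr}[e^{-\beta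 H}]$, for all Hermitian operators $O_1,O_2$ supported on sets $A_1,A_2\subseteq\Lambda$ with $|A_1|+|A_2|\le K$, $$\Big|\mathrm{Tr}[\rho_\beta(H)O_1O_2]-\mathrm{Tr}[\rho_\beta(H)O_1]\,\mathrm{Tr}[\rho_\beta(H)O_2]\Big|\le C\,\|O_1\|\,\|O_2\|\,e^{-\mathrm{dist}(A_1,A_2)/\xi},$$ where $\mathrm{dist}(A_1,A_2)=\min_{x\in A_1,\,y\in A_2}\mathrm{dist}(x,y)$, read as $0$ if $A_1$ or $A_2$ is empty. In particular the bound has no factor of $n$ and holds at every distance. -/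

import Mathlib

open scoped Matrix.Norms.L2Operator ComplexOrder

noncomputable section

namespace QuantumLattice

/-- The sites of the lattice `ℤ^D`. -/
abbrev Site (D : ℕ) : Type := Fin D → ℤ

/-- The lattice (graph, i.e. `ℓ¹`) distance on `ℤ^D`. -/
def siteDist {D : ℕ} (x y : Site D) : ℕ := ∑ i, (x i - y i).natAbs

/-- Operators on `⨂_{x ∈ Λ} ℂ^d`, written in the product basis labelled by the configurations
`Λ → Fin d`. The norm `‖O‖` is the operator norm with respect to the Hilbert space norm. -/
abbrev Operator {D : ℕ} (Λ : Finset (Site D)) (d : ℕ) : Type :=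
  Matrix (Λ → Fin d) (Λ → Fin d) ℂ

variable {D d : ℕ} {Λ : Finset (Site D)}

/-- `O` acts non-trivially only on the sites in `A`: `O = M ⊗ 1` with `M` an operator on
`⨂_{x ∈ A} ℂ^d` and `1` the identity on the sites of `Λ` outside `A`. -/
def SupportedOn (A : Finset Λ) (O : Operator Λ d) : Prop :=
  ∃ M : Matrix (A → Fin d) (A → Fin d) ℂ, ∀ σ τ : Λ → Fin d,
    O σ τ = if ∀ x, x ∉ A → σ x = τ x then M (fun x => σ x) (fun x => τ x) else 0

/-- The diameter of a region. -/
def regionDiam (X : Finset Λ) : ℕ :=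
  (X ×ˢ X).sup fun p => siteDist (p.1 : Site D) (p.2 : Site D)

/-- The distance of two regions, the minimum of `dist(x, y)` over `x ∈ A`, `y ∈ B`
(by convention `0` if one of them is empty). -/
def regionDist (A B : Finset Λ) : ℕ :=
  sInf {r | ∃ x ∈ A, ∃ y ∈ B, siteDist (x : Site D) (y : Site D) = r}

/-- A `(κ, R)`-local Hamiltonian `H = ∑_{X ⊆ Λ} H_X` on the finite lattice `Λ ⊂ ℤ^D` of
`d`-dimensional qudits, with local terms of norm at most `h`. -/
structure LocalHamiltonian (Λ : Finset (Site D)) (d κ R : ℕ) (h : ℝ) where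
  /-- The local term `H_X`. -/
  term : Finset Λ → Operator Λ d
  isHermitian : ∀ X, (term X).IsHermitian
  supportedOn : ∀ X, SupportedOn X (term X)
  norm_le : ∀ X, ‖term X‖ ≤ h
  eq_zero : ∀ X, R < regionDiam X ∨ κ < X.card → term X = 0

namespace LocalHamiltonian

variable {κ R : ℕ} {h : ℝ}

/-- The local terms commute with each other. -/
def MutuallyCommuting (H : LocalHamiltonian Λ d κ R h) : Prop :=
  ∀ X Y, Commute (H.term X) (H.term Y)

/-- The weighted Hamiltonian `∑_X z_X H_X`. -/
def weighted (H : LocalHamiltonian Λ d κ R h) (z : Finset Λ → ℂ) : Operator Λ d :=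
  ∑ X, z X • H.term X

/-- The Gibbs state `ρ_β(H) = e^{-βH} / Tr[e^{-βH}]`. -/
def gibbs (H : LocalHamiltonian Λ d κ R h) (β : ℝ) : Operator Λ d :=
  (Matrix.trace (NormedSpace.exp (-H.weighted fun _ => (β : ℂ))))⁻¹ •
    NormedSpace.exp (-H.weighted fun _ => (β : ℂ))

/-- The set `Γ_{δ,β}` of all tuples `z` with `|z_X - β| ≤ δ` for every `X`. -/
def vicinity (Λ : Finset (Site D)) (δ β : ℝ) : Set (Finset Λ → ℂ) :=
  {z | ∀ X, ‖z X - (β : ℂ)‖ ≤ δ}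

/-- Analyticity after measurement at `β`, for measurement operators `N` that act on at most `K`
sites and with the constant `c`: for all `N ≥ 0` with `‖N‖ = 1` and all `z ∈ Γ_{δ,β}`,
`Tr[e^{-∑ z_X H_X} N] ≠ 0` and `|log Tr[e^{-∑ z_X H_X} N]| ≤ c n`, where `n` is the number of
sites. (The principal logarithm has the least modulus among all logarithms.) -/
def AnalyticAfterMeasurement (H : LocalHamiltonian Λ d κ R h) (K : ℕ) (δ c β : ℝ) : Prop :=
  ∀ (A : Finset Λ) (N : Operator Λ d), A.card ≤ K → SupportedOn A N → N.PosSemidef → ‖N‖ = 1 →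
    ∀ z ∈ vicinity Λ δ β,
      Matrix.trace (NormedSpace.exp (-H.weighted z) * N) ≠ 0 ∧
      ‖Complex.log (Matrix.trace (NormedSpace.exp (-H.weighted z) * N))‖ ≤ c * (Λ.card : ℝ)

/-- Exponential decay of correlations in `ρ_β(H)` with constants `C` and `ξ`, for Hermitian
observables that act on at most `K` sites in total. -/
def ExponentialDecay (H : LocalHamiltonian Λ d κ R h) (K : ℕ) (C ξ β : ℝ) : Prop :=
  ∀ (A₁ A₂ : Finset Λ) (O₁ O₂ : Operator Λ d), A₁.card + A₂.card ≤ K →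
    SupportedOn A₁ O₁ → SupportedOn A₂ O₂ → O₁.IsHermitian → O₂.IsHermitian →
    ‖Matrix.trace (H.gibbs β * O₁ * O₂) -
        Matrix.trace (H.gibbs β * O₁) * Matrix.trace (H.gibbs β * O₂)‖ ≤
      C * ‖O₁‖ * ‖O₂‖ * Real.exp (-(regionDist A₁ A₂ : ℝ) / ξ)

end LocalHamiltonian

end QuantumLattice

end

open Metric Filter Topology Asymptotics
open scoped Kronecker MatrixOrder

/-! ### Complex analysis on the disc -/

/-- A Schwarz lemma for functions with a zero of high order. -/
theorem norm_le_mul_pow_of_isBigO {r : ℝ} (hr : 0 < r) (k : ℕ) : ∀ {f : ℂ → ℂ} {C : ℝ},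
    DifferentiableOn ℂ f (ball 0 r) → (∀ w ∈ ball (0 : ℂ) r, ‖f w‖ ≤ C) →
    f =O[𝓝[≠] 0] (fun w => w ^ k) → ∀ w ∈ ball (0 : ℂ) r, ‖f w‖ ≤ C * (‖w‖ / r) ^ k := by
  induction k with
  | zero => intro f C _ hC _ w hw; simpa using hC w hw
  | succ k ih =>
    intro f C hf hC hO w hw
    have hmem : ball (0 : ℂ) r ∈ 𝓝 (0 : ℂ) := ball_mem_nhds 0 hr
    have h0 : f 0 = 0 := by
      have h1 : Tendsto f (𝓝[≠] 0) (𝓝 (f 0)) :=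
        ((hf.differentiableAt hmem).continuousAt.tendsto).mono_left nhdsWithin_le_nhds
      have h2 : Tendsto f (𝓝[≠] 0) (𝓝 0) := by
        refine hO.trans_tendsto ?_
        have : Tendsto (fun w : ℂ => w ^ (k + 1)) (𝓝 0) (𝓝 (0 ^ (k + 1))) :=
          (continuous_pow (k + 1)).tendsto 0
        rw [zero_pow (Nat.succ_ne_zero k)] at this
        exact this.mono_left nhdsWithin_le_nhds
      exact tendsto_nhds_unique h1 h2
    -- Dividing out one zero costs a factor 1/r in the bound, by the usual Schwarz lemma, and lowers
    -- the order by one.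
    have hg : DifferentiableOn ℂ (dslope f 0) (ball 0 r) :=
      (Complex.differentiableOn_dslope hmem).2 hf
    have hgC : ∀ w ∈ ball (0 : ℂ) r, ‖dslope f 0 w‖ ≤ C / r := fun w hw =>
      Complex.norm_dslope_le_div_of_mapsTo_ball hf
        (fun z hz => by simpa [h0] using hC z hz) hw
    have hgO : dslope f 0 =O[𝓝[≠] 0] (fun w => w ^ k) := by
      obtain ⟨M, hM⟩ := hO.bound
      refine IsBigO.of_bound M ?_
      filter_upwards [hM, self_mem_nhdsWithin] with z hz hz0
      have hz0 : z ≠ 0 := hz0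
      have hpos : 0 < ‖z‖ := norm_pos_iff.2 hz0
      rw [dslope_of_ne _ hz0, slope_def_field, h0, sub_zero, sub_zero, norm_div,
        div_le_iff₀ hpos]
      simpa [pow_succ, mul_assoc] using hz
    have := ih hg hgC hgO w hw
    by_cases hw0 : w = 0
    · subst hw0; simp [h0]
    have hfw : f w = w * dslope f 0 w := by
      rw [dslope_of_ne _ hw0, slope_def_field, h0]; field_simp; ring
    rw [hfw, norm_mul]
    calc ‖w‖ * ‖dslope f 0 w‖ ≤ ‖w‖ * (C / r * (‖w‖ / r) ^ k) := by gcongr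
      _ = C * (‖w‖ / r) ^ (k + 1) := by ring

/-- The Cayley transform (s - a)/(s + ā), a = s(0), sends the right half-plane to the disc and a to
0. Schwarz gives ‖s - a‖ ≤ ‖w‖ ‖s + ā‖, which is solved for ‖s‖. -/
theorem norm_le_of_re_pos {s : ℂ → ℂ} (hs : DifferentiableOn ℂ s (ball 0 1))
    (hpos : ∀ w ∈ ball (0 : ℂ) 1, 0 < (s w).re) {w : ℂ} (hw : w ∈ ball (0 : ℂ) 1) :
    ‖s w‖ ≤ ‖s 0‖ * ((1 + ‖w‖) / (1 - ‖w‖)) := by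
  have hw1 : ‖w‖ < 1 := by simpa using hw
  set a := s 0 with ha
  have ha0 : 0 < a.re := hpos 0 (by simp)
  have hne : ∀ w ∈ ball (0 : ℂ) 1, s w + star a ≠ 0 := by
    intro w hw h
    have := congrArg Complex.re h
    have h1 := hpos w hw
    simp at this
    linarith
  have hlt : ∀ w ∈ ball (0 : ℂ) 1, ‖(s w - a) / (s w + star a)‖ ≤ 1 := by
    intro w hw
    rw [norm_div, div_le_one (norm_pos_iff.2 (hne w hw))]
    have h1 := hpos w hw
    rw [← sq_le_sq₀ (norm_nonneg _) (norm_nonneg _), Complex.sq_norm, Complex.sq_norm,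
      Complex.normSq_apply, Complex.normSq_apply]
    simp
    nlinarith
  have hd : DifferentiableOn ℂ (fun w => (s w - a) / (s w + star a)) (ball 0 1) :=
    (hs.sub_const a).div (hs.add_const _) hne
  have hO : (fun w => (s w - a) / (s w + star a)) =O[𝓝[≠] 0] (fun w : ℂ => w ^ 1) := by
    have := (hd.differentiableAt (ball_mem_nhds 0 one_pos)).isBigO_sub
    simpa [← ha] using this.mono nhdsWithin_le_nhds
  have key := norm_le_mul_pow_of_isBigO one_pos 1 hd hlt hO w hw
  simp only [one_mul, pow_one, div_one, norm_div] at key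
  rw [div_le_iff₀ (norm_pos_iff.2 (hne w hw))] at key
  have h1 : ‖s w‖ ≤ ‖s w - a‖ + ‖a‖ := by simpa using norm_add_le (s w - a) a
  have h2 : ‖s w + star a‖ ≤ ‖s w‖ + ‖a‖ := by simpa using norm_add_le (s w) (star a)
  have h3 : ‖w‖ * ‖s w + star a‖ ≤ ‖w‖ * (‖s w‖ + ‖a‖) := by gcongr
  rw [mul_div_assoc', le_div_iff₀ (by linarith)]
  linarith

/-- The principal square root takes the slit plane to the right half-plane, so the half-plane bound
applies to it and is then squared. -/
theorem norm_le_of_mem_slitPlane {f : ℂ → ℂ} (hf : DifferentiableOn ℂ f (ball 0 1))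
    (hpos : ∀ w ∈ ball (0 : ℂ) 1, f w ∈ Complex.slitPlane) {w : ℂ} (hw : w ∈ ball (0 : ℂ) 1) :
    ‖f w‖ ≤ ‖f 0‖ * ((1 + ‖w‖) / (1 - ‖w‖)) ^ 2 := by
  set s : ℂ → ℂ := fun w => Complex.exp (Complex.log (f w) / 2) with hs
  have hsq : ∀ w ∈ ball (0 : ℂ) 1, s w ^ 2 = f w := by
    intro w hw
    rw [hs, ← Complex.exp_nat_mul]
    push_cast
    rw [mul_div_cancel₀ _ two_ne_zero, Complex.exp_log (Complex.slitPlane_ne_zero (hpos w hw))]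
  have hd : DifferentiableOn ℂ s (ball 0 1) :=
    ((hf.clog hpos).div_const 2).cexp
  have hre : ∀ w ∈ ball (0 : ℂ) 1, 0 < (s w).re := by
    intro w hw
    have h1 := Complex.neg_pi_lt_arg (f w)
    have h2 : (f w).arg < Real.pi := lt_of_le_of_ne (Complex.arg_le_pi _)
      (Complex.mem_slitPlane_iff_arg.1 (hpos w hw)).1
    have h3 : (Complex.log (f w) / 2).im = (f w).arg / 2 := by
      rw [show (2 : ℂ) = ((2 : ℝ) : ℂ) by norm_num, Complex.div_ofReal_im, Complex.log_im]
    simp only [hs]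
    rw [Complex.exp_re, h3]
    exact mul_pos (Real.exp_pos _) (Real.cos_pos_of_mem_Ioo ⟨by linarith, by linarith⟩)
  have := norm_le_of_re_pos hd hre hw
  rw [← hsq w hw, ← hsq 0 (by simp), norm_pow, norm_pow, ← mul_pow]
  gcongr

/-- A map of the unit disc into a thin neighbourhood of the segment `[0, β]` which takes `0` to `0`
and an interior point to `β`. -/
theorem exists_disc_map {β δ : ℝ} (hβ : 0 ≤ β) (hδ : 0 < δ) :
    ∃ (ψ : ℂ → ℂ) (w₀ : ℝ), 0 < w₀ ∧ w₀ < 1 ∧ ψ 0 = 0 ∧ ψ w₀ = β ∧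
      DifferentiableOn ℂ ψ (ball 0 1) ∧
      ∀ w ∈ ball (0 : ℂ) 1, ∃ β' ∈ Set.Icc 0 β, ‖ψ w - (β' : ℂ)‖ ≤ δ := by
  -- The map is ψ(w) = -(β/l) log(1 - rw), with 1 - rw₀ = e^{-l}. As e^{-(l+1)} ≤ |1 - rw| ≤ e and
  -- |arg| ≤ 2, ψ overshoots [0, β] by at most β/l in the real direction and 2β/l in the imaginary
  -- one, whence the 3. The +1 keeps l positive when β = 0.
  set l : ℝ := 3 * β / δ + 1 with hl
  have hl0 : 0 < l := by positivity
  have hβl : 3 * (β / l) ≤ δ := by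
    rw [mul_div_assoc', div_le_iff₀ hl0, hl]
    field_simp
    linarith
  set r : ℝ := 1 - Real.exp (-(l + 1)) with hr
  have he : Real.exp (-(l + 1)) < Real.exp (-l) := Real.exp_lt_exp.2 (by linarith)
  have he1 : Real.exp (-l) < 1 :=
    (Real.exp_lt_exp.2 (by linarith : -l < 0)).trans_eq Real.exp_zero
  have hr0 : 0 < r := by linarith
  have hr1 : r < 1 := by have := Real.exp_pos (-(l + 1)); linarith
  have hb : ∀ w ∈ ball (0 : ℂ) 1, ‖(r : ℂ) * w‖ ≤ r := by
    intro w hw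
    rw [norm_mul, Complex.norm_real, Real.norm_of_nonneg hr0.le]
    have : ‖w‖ < 1 := by simpa using hw
    nlinarith
  have hre : ∀ w ∈ ball (0 : ℂ) 1, 0 < (1 - (r : ℂ) * w).re := by
    intro w hw
    have := (Complex.re_le_norm ((r : ℂ) * w)).trans (hb w hw)
    rw [Complex.sub_re, Complex.one_re]
    linarith
  have hw0 : (1 - (r : ℂ) * (((1 - Real.exp (-l)) / r : ℝ) : ℂ)) = ((Real.exp (-l) : ℝ) : ℂ) := by
    rw [← Complex.ofReal_mul, mul_div_cancel₀ _ hr0.ne']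
    push_cast; ring
  refine ⟨fun w => -((β / l : ℝ) : ℂ) * Complex.log (1 - r * w), (1 - Real.exp (-l)) / r,
    div_pos (by linarith) hr0, (div_lt_one hr0).2 (by linarith), by simp, ?_, ?_, ?_⟩
  · simp only [hw0]
    rw [← Complex.ofReal_log (Real.exp_pos _).le, Real.log_exp, ← Complex.ofReal_neg,
      ← Complex.ofReal_mul]
    congr 1
    field_simp
  · refine DifferentiableOn.const_mul (DifferentiableOn.clog ?_ ?_) _
    · exact (differentiable_const _).differentiableOn.sub
        (differentiable_id.const_mul _).differentiableOn
    · intro w hw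
      exact Or.inl (hre w hw)
  · intro w hw
    set u : ℂ := 1 - (r : ℂ) * w with hu
    have hu1 : Real.exp (-(l + 1)) ≤ ‖u‖ := by
      have := norm_sub_norm_le (1 : ℂ) (r * w)
      have h2 := hb w hw
      rw [norm_one] at this
      linarith
    have hu0 : 0 < ‖u‖ := (Real.exp_pos _).trans_le hu1
    have hu2 : ‖u‖ ≤ Real.exp 1 := by
      have := norm_sub_le (1 : ℂ) (r * w)
      have h2 := hb w hw
      have h3 := Real.add_one_le_exp (1 : ℝ)
      rw [norm_one] at this
      linarith
    have hlog1 : -(l + 1) ≤ Real.log ‖u‖ := (Real.le_log_iff_exp_le hu0).2 hu1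
    have hlog2 : Real.log ‖u‖ ≤ 1 := (Real.log_le_iff_le_exp hu0).2 hu2
    have harg : |u.arg| ≤ 2 := by
      have := (Complex.abs_arg_lt_pi_div_two_iff (z := u)).2 (Or.inl (hre w hw))
      have := Real.pi_le_four
      linarith
    set e : ℝ := β / l with he
    have he0 : 0 ≤ e := by positivity
    have hel : e * l = β := div_mul_cancel₀ _ hl0.ne'
    set t : ℂ := -(e : ℂ) * Complex.log u with ht
    have htre : t.re = -e * Real.log ‖u‖ := by simp [ht, Complex.log_re]
    have htim : t.im = -e * u.arg := by simp [ht, Complex.log_im]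
    have h1 : t.re ≤ β + e := by rw [htre]; nlinarith
    have h2 : -e ≤ t.re := by rw [htre]; nlinarith
    -- The projection of Re t onto [0, β].
    refine ⟨max 0 (min β t.re), ⟨le_max_left _ _, max_le hβ (min_le_left _ _)⟩, ?_⟩
    refine (Complex.norm_le_abs_re_add_abs_im _).trans ?_
    have h3 : |(t - ((max 0 (min β t.re) : ℝ) : ℂ)).re| ≤ e := by
      rw [Complex.sub_re, Complex.ofReal_re, abs_le]
      rcases max_cases 0 (min β t.re) with h | h <;> rcases min_cases β t.re with h' | h' <;>
        constructor <;> linarith [h.1, h.2, h'.1, h'.2]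
    have h4 : |(t - ((max 0 (min β t.re) : ℝ) : ℂ)).im| ≤ e * 2 := by
      rw [Complex.sub_im, Complex.ofReal_im, sub_zero, htim, abs_mul, abs_neg, abs_of_nonneg he0]
      gcongr
    linarith

/-! ### Matrix exponentials, traces and positivity -/

namespace Matrix

variable {m n : Type*} [Fintype m] [DecidableEq m] [Fintype n] [DecidableEq n]

theorem exp_kronecker_one (A : Matrix m m ℂ) :
    NormedSpace.exp (A ⊗ₖ (1 : Matrix n n ℂ)) = NormedSpace.exp A ⊗ₖ (1 : Matrix n n ℂ) := by
  let f : Matrix m m ℂ →+* Matrix (m × n) (m × n) ℂ :=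
    { toFun := fun A => A ⊗ₖ (1 : Matrix n n ℂ)
      map_one' := one_kronecker_one
      map_mul' := fun A B => by rw [← mul_kronecker_mul, one_mul]
      map_zero' := zero_kronecker _
      map_add' := fun A B => add_kronecker _ _ _ }
  have hf : Continuous f := LinearMap.continuous_of_finiteDimensional
    ((kroneckerBilinear (l := m) (m := m) (n := n) (p := n) (R := ℂ) (α := ℂ)).flip 1)
  let _ : NormedAlgebra ℚ (Matrix m m ℂ) := NormedAlgebra.restrictScalars ℚ ℂ _
  exact (NormedSpace.map_exp f hf A).symm

theorem exp_one_kronecker (A : Matrix n n ℂ) :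
    NormedSpace.exp ((1 : Matrix m m ℂ) ⊗ₖ A) = (1 : Matrix m m ℂ) ⊗ₖ NormedSpace.exp A := by
  let f : Matrix n n ℂ →+* Matrix (m × n) (m × n) ℂ :=
    { toFun := fun A => (1 : Matrix m m ℂ) ⊗ₖ A
      map_one' := one_kronecker_one
      map_mul' := fun A B => by rw [← mul_kronecker_mul, one_mul]
      map_zero' := kronecker_zero _
      map_add' := fun A B => kronecker_add _ _ _ }
  have hf : Continuous f := LinearMap.continuous_of_finiteDimensional
    (kroneckerBilinear (l := m) (m := m) (n := n) (p := n) (R := ℂ) (α := ℂ) 1)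
  let _ : NormedAlgebra ℚ (Matrix n n ℂ) := NormedAlgebra.restrictScalars ℚ ℂ _
  exact (NormedSpace.map_exp f hf A).symm

theorem exp_kronecker_one_add_one_kronecker (A : Matrix m m ℂ) (B : Matrix n n ℂ) :
    NormedSpace.exp (A ⊗ₖ (1 : Matrix n n ℂ) + (1 : Matrix m m ℂ) ⊗ₖ B) =
      NormedSpace.exp A ⊗ₖ NormedSpace.exp B := by
  rw [exp_add_of_commute, exp_kronecker_one, exp_one_kronecker, ← mul_kronecker_mul, mul_one,
    one_mul]
  rw [Commute, SemiconjBy, ← mul_kronecker_mul, ← mul_kronecker_mul]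
  simp

theorem trace_submatrix_equiv {m n : Type*} [Fintype m] [Fintype n] (e : n ≃ m)
    (A : Matrix m m ℂ) :
    (A.submatrix e e).trace = A.trace := by
  simpa [trace] using Equiv.sum_comp e fun i => A i i

/-- The expansion of `Tr[e^A Q]` starts at order `k` if the first `k` moments vanish. -/
theorem trace_exp_mul_isBigO (A Q : Matrix n n ℂ) (k : ℕ)
    (h : ∀ j < k, (A ^ j * Q).trace = 0) :
    (fun t : ℂ => (NormedSpace.exp (t • A) * Q).trace) =O[𝓝 0] fun t => t ^ k := by
  have h1 := (NormedSpace.exp_hasFPowerSeriesAt_zero (𝕂 := ℂ)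
    (𝔸 := Matrix n n ℂ)).isBigO_sub_partialSum_pow k
  have h2 : Tendsto (fun t : ℂ => t • A) (𝓝 0) (𝓝 0) := by
    have : Continuous fun t : ℂ => t • A := by fun_prop
    simpa using this.tendsto 0
  have h3 := h1.comp_tendsto h2
  let T : Matrix n n ℂ →L[ℂ] ℂ := LinearMap.toContinuousLinearMap
    ((traceLinearMap n ℂ ℂ).comp (LinearMap.mulRight ℂ Q))
  have hT : ∀ M, T M = (M * Q).trace := fun M => rfl
  have h4 := (T.isBigO_comp _ (𝓝 0)).trans h3
  have h5 : (fun t : ℂ => ‖t • A‖ ^ k) =O[𝓝 0] fun t => t ^ k := by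
    refine IsBigO.of_bound (‖A‖ ^ k) (Eventually.of_forall fun t => ?_)
    rw [norm_smul, mul_pow, norm_mul, norm_pow, norm_pow, norm_norm, norm_pow, norm_norm, mul_comm]
  refine (IsBigO.trans ?_ h5)
  refine h4.congr_left fun t => ?_
  simp only [Function.comp, zero_add, hT]
  rw [sub_mul, trace_sub, sub_eq_self, FormalMultilinearSeries.partialSum, Finset.sum_mul,
    trace_sum]
  refine Finset.sum_eq_zero fun j hj => ?_
  rw [NormedSpace.expSeries_apply_eq, smul_pow, smul_mul_assoc, smul_mul_assoc, trace_smul,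
    trace_smul, h j (Finset.mem_range.1 hj), smul_zero, smul_zero]

theorem IsHermitian.posSemidef_smul_one_add {M : Matrix n n ℂ} (hM : M.IsHermitian)
    (hM1 : ‖M‖ ≤ 1) {c : ℝ} (hc : 1 ≤ c) : ((c : ℂ) • (1 : Matrix n n ℂ) + M).PosSemidef := by
  have h1 : -algebraMap ℝ (Matrix n n ℂ) ‖M‖ ≤ M :=
    IsSelfAdjoint.neg_algebraMap_norm_le_self (a := M) hM
  have h2 : (M + algebraMap ℝ (Matrix n n ℂ) ‖M‖).PosSemidef := by
    rw [le_iff, sub_neg_eq_add] at h1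
    exact h1
  have h3 : (((c - ‖M‖ : ℝ) : ℂ) • (1 : Matrix n n ℂ)).PosSemidef :=
    PosSemidef.one.smul (by rw [Complex.zero_le_real]; linarith)
  convert h3.add h2 using 1
  rw [Algebra.algebraMap_eq_smul_one, Complex.ofReal_sub, sub_smul]
  simp only [Complex.coe_smul]
  abel

theorem norm_trace_le {M : Matrix n n ℂ} (hM : M.IsHermitian) (hM1 : ‖M‖ ≤ 1) :
    ‖M.trace‖ ≤ Fintype.card n := by
  have h1 := (hM.posSemidef_smul_one_add hM1 le_rfl).trace_nonneg
  have h2 := (hM.neg.posSemidef_smul_one_add (by rwa [norm_neg]) le_rfl).trace_nonneg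
  rw [trace_add, trace_smul, trace_one] at h1 h2
  rw [trace_neg] at h2
  rw [Complex.le_def] at h1 h2
  simp at h1 h2
  rw [show M.trace = ((M.trace.re : ℝ) : ℂ) from Complex.ext rfl (by simp [← h1.2]),
    Complex.norm_real, Real.norm_eq_abs, abs_le]
  constructor <;> linarith [h1.1, h2.1]

end Matrix

/-! ### Supports of operators and the partial exchange of two copies -/

namespace QuantumLattice

variable {D d : ℕ} {Λ : Finset (Site D)} {A B : Finset Λ} {O O' : Operator Λ d}

theorem supportedOn_iff_exists_kronecker : SupportedOn A O ↔
    ∃ M : Matrix (A → Fin d) (A → Fin d) ℂ,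
      O = (M ⊗ₖ (1 : Matrix ({x // x ∉ A} → Fin d) ({x // x ∉ A} → Fin d) ℂ)).submatrix
        (Equiv.piEquivPiSubtypeProd (· ∈ A) fun _ => Fin d)
        (Equiv.piEquivPiSubtypeProd (· ∈ A) fun _ => Fin d) := by
  refine exists_congr fun M => ?_
  rw [← Matrix.ext_iff]
  refine forall_congr' fun σ => forall_congr' fun τ => ?_
  have : (fun x : {x // x ∉ A} => σ x) = (fun x : {x // x ∉ A} => τ x) ↔
      ∀ x, x ∉ A → σ x = τ x := by
    rw [funext_iff, Subtype.forall]
  simp [Matrix.kroneckerMap_apply, Matrix.one_apply, Equiv.piEquivPiSubtypeProd, this]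

theorem SupportedOn.mono (hO : SupportedOn A O) (h : A ⊆ B) : SupportedOn B O := by
  obtain ⟨M, hM⟩ := hO
  refine ⟨Matrix.of fun s t => if ∀ x : B, (x : Λ) ∉ A → s x = t x then
    M (fun x => s ⟨x, h x.2⟩) (fun x => t ⟨x, h x.2⟩) else 0, fun σ τ => ?_⟩
  rw [hM, Matrix.of_apply]
  by_cases h1 : ∀ x, x ∉ A → σ x = τ x
  · rw [if_pos h1, if_pos fun x hx => h1 x fun hA => hx (h hA), if_pos fun (x : B) hx => h1 x hx]
  · rw [if_neg h1]
    by_cases h2 : ∀ x, x ∉ B → σ x = τ x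
    · rw [if_pos h2, if_neg]
      intro h3
      exact h1 fun x hx => if hB : x ∈ B then h3 ⟨x, hB⟩ hx else h2 x hB
    · rw [if_neg h2]

theorem SupportedOn.add (hO : SupportedOn A O) (hO' : SupportedOn A O') :
    SupportedOn A (O + O') := by
  rw [supportedOn_iff_exists_kronecker] at *
  obtain ⟨M, rfl⟩ := hO
  obtain ⟨M', rfl⟩ := hO'
  exact ⟨M + M', by rw [Matrix.add_kronecker]; rfl⟩

theorem SupportedOn.smul (c : ℂ) (hO : SupportedOn A O) : SupportedOn A (c • O) := by
  rw [supportedOn_iff_exists_kronecker] at *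
  obtain ⟨M, rfl⟩ := hO
  exact ⟨c • M, by rw [Matrix.smul_kronecker]; rfl⟩

theorem supportedOn_one : SupportedOn A (1 : Operator Λ d) := by
  rw [supportedOn_iff_exists_kronecker]
  exact ⟨1, by rw [Matrix.one_kronecker_one, Matrix.submatrix_one_equiv]⟩

theorem SupportedOn.mul (hO : SupportedOn A O) (hO' : SupportedOn A O') :
    SupportedOn A (O * O') := by
  rw [supportedOn_iff_exists_kronecker] at *
  obtain ⟨M, rfl⟩ := hO
  obtain ⟨M', rfl⟩ := hO'
  refine ⟨M * M', ?_⟩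
  rw [Matrix.submatrix_mul_equiv, ← Matrix.mul_kronecker_mul, one_mul]

theorem SupportedOn.conjTranspose (hO : SupportedOn A O) : SupportedOn A O.conjTranspose := by
  rw [supportedOn_iff_exists_kronecker] at *
  obtain ⟨M, rfl⟩ := hO
  refine ⟨M.conjTranspose, ?_⟩
  rw [Matrix.conjTranspose_submatrix, Matrix.conjTranspose_kronecker, Matrix.conjTranspose_one]

/-- The exchange of the two copies of the configuration space on the sites of `B`. -/
def exchange (B : Finset Λ) :
    Equiv.Perm ((Λ → Fin d) × (Λ → Fin d)) :=
  Function.Involutive.toPerm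
    (fun p => (fun x => if x ∈ B then p.2 x else p.1 x, fun x => if x ∈ B then p.1 x else p.2 x))
    fun p => by ext x <;> by_cases hx : x ∈ B <;> simp [hx]

theorem exchange_apply (B : Finset Λ) (p : (Λ → Fin d) × (Λ → Fin d)) : exchange B p =
    (fun x => if x ∈ B then p.2 x else p.1 x, fun x => if x ∈ B then p.1 x else p.2 x) := rfl

theorem exchange_exchange (B : Finset Λ) (p : (Λ → Fin d) × (Λ → Fin d)) :
    exchange B (exchange B p) = p := (exchange B).left_inv p

theorem SupportedOn.exchange_kronecker_one_of_subset (hO : SupportedOn A O) (h : A ⊆ B) :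
    (O ⊗ₖ (1 : Operator Λ d)).submatrix (exchange B) (exchange B) = 1 ⊗ₖ O := by
  obtain ⟨M, hM⟩ := hO
  ext ⟨σ, τ⟩ ⟨σ', τ'⟩
  simp only [Matrix.submatrix_apply, exchange_apply, Matrix.kroneckerMap_apply, Matrix.one_apply,
    hM, funext_iff, mul_ite, ite_mul, mul_one, one_mul, mul_zero, zero_mul]
  have e1 : (fun x : A => if (x : Λ) ∈ B then τ x else σ x) = fun x : A => τ x := by
    ext x; rw [if_pos (h x.2)]
  have e2 : (fun x : A => if (x : Λ) ∈ B then τ' x else σ' x) = fun x : A => τ' x := by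
    ext x; rw [if_pos (h x.2)]
  rw [e1, e2, ← ite_and, ← ite_and]
  congr 1
  rw [eq_iff_iff]
  constructor
  · rintro ⟨h1, h2⟩
    refine ⟨fun x hx => ?_, fun x => ?_⟩ <;> by_cases hB : x ∈ B
    · simpa [hB] using h2 x hx
    · simpa [hB] using h1 x
    · simpa [hB] using h1 x
    · simpa [hB] using h2 x fun hA => hB (h hA)
  · rintro ⟨h1, h2⟩
    refine ⟨fun x => ?_, fun x hx => ?_⟩ <;> by_cases hB : x ∈ B
    · simpa [hB] using h2 x
    · simpa [hB] using h1 x fun hA => hB (h hA)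
    · simpa [hB] using h1 x hx
    · simpa [hB] using h2 x

theorem SupportedOn.exchange_one_kronecker_of_subset (hO : SupportedOn A O) (h : A ⊆ B) :
    ((1 : Operator Λ d) ⊗ₖ O).submatrix (exchange B) (exchange B) = O ⊗ₖ 1 := by
  rw [← hO.exchange_kronecker_one_of_subset h, Matrix.submatrix_submatrix]
  ext p q
  simp only [Matrix.submatrix_apply, Function.comp, exchange_exchange]

theorem SupportedOn.exchange_kronecker_one_of_disjoint (hO : SupportedOn A O)
    (h : Disjoint A B) :
    (O ⊗ₖ (1 : Operator Λ d)).submatrix (exchange B) (exchange B) = O ⊗ₖ 1 := by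
  obtain ⟨M, hM⟩ := hO
  ext ⟨σ, τ⟩ ⟨σ', τ'⟩
  simp only [Matrix.submatrix_apply, exchange_apply, Matrix.kroneckerMap_apply, Matrix.one_apply,
    hM, funext_iff, mul_ite, mul_one, mul_zero]
  have e1 : (fun x : A => if (x : Λ) ∈ B then τ x else σ x) = fun x : A => σ x := by
    ext x; rw [if_neg (Finset.disjoint_left.1 h x.2)]
  have e2 : (fun x : A => if (x : Λ) ∈ B then τ' x else σ' x) = fun x : A => σ' x := by
    ext x; rw [if_neg (Finset.disjoint_left.1 h x.2)]
  rw [e1, e2, ← ite_and, ← ite_and]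
  congr 1
  rw [eq_iff_iff]
  constructor
  · rintro ⟨h1, h2⟩
    refine ⟨fun x => ?_, fun x hx => ?_⟩ <;> by_cases hB : x ∈ B
    · simpa [hB] using h2 x fun hA => Finset.disjoint_left.1 h hA hB
    · simpa [hB] using h1 x
    · simpa [hB] using h1 x
    · simpa [hB] using h2 x hx
  · rintro ⟨h1, h2⟩
    refine ⟨fun x => ?_, fun x hx => ?_⟩ <;> by_cases hB : x ∈ B
    · simpa [hB] using h2 x fun hA => Finset.disjoint_left.1 h hA hB
    · simpa [hB] using h1 x
    · simpa [hB] using h1 x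
    · simpa [hB] using h2 x hx

/-- Follows from the statement for the first copy by conjugating with the exchange of all sites,
which commutes with `exchange B`. -/
theorem SupportedOn.exchange_one_kronecker_of_disjoint (hO : SupportedOn A O)
    (h : Disjoint A B) :
    ((1 : Operator Λ d) ⊗ₖ O).submatrix (exchange B) (exchange B) = 1 ⊗ₖ O := by
  have h1 := hO.exchange_kronecker_one_of_subset (Finset.subset_univ A)
  have h2 := hO.exchange_kronecker_one_of_disjoint h
  rw [← h1]
  conv_rhs => rw [← h2]
  ext ⟨σ, τ⟩ ⟨σ', τ'⟩
  simp only [Matrix.submatrix_apply]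
  have comm : ∀ p : (Λ → Fin d) × (Λ → Fin d),
      exchange Finset.univ (exchange B p) = exchange B (exchange Finset.univ p) := by
    intro p
    simp [exchange_apply]
  rw [comm, comm]

end QuantumLattice

/-! ### The doubled system -/

namespace Matrix

variable {n : Type*} [Fintype n] [DecidableEq n]

/-- The sum of the actions of `O` on the two factors of a doubled system. -/
def doubled (O : Matrix n n ℂ) : Matrix (n × n) (n × n) ℂ := O ⊗ₖ 1 + 1 ⊗ₖ O

/-- The difference of the actions of `O` on the two factors of a doubled system. -/
def antidoubled (O : Matrix n n ℂ) : Matrix (n × n) (n × n) ℂ := O ⊗ₖ 1 - 1 ⊗ₖ O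

theorem doubled_sum {n ι : Type*} [DecidableEq n] (s : Finset ι) (f : ι → Matrix n n ℂ) :
    doubled (∑ i ∈ s, f i) = ∑ i ∈ s, doubled (f i) := by
  classical
  induction s using Finset.induction_on with
  | empty => simp [doubled]
  | insert a s ha ih =>
    rw [Finset.sum_insert ha, Finset.sum_insert ha, ← ih, doubled, doubled, doubled,
      add_kronecker, kronecker_add]
    abel

theorem exp_smul_doubled (t : ℂ) (A : Matrix n n ℂ) :
    NormedSpace.exp (t • doubled A) = NormedSpace.exp (t • A) ⊗ₖ NormedSpace.exp (t • A) := by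
  rw [← exp_kronecker_one_add_one_kronecker, doubled, smul_add, smul_kronecker, kronecker_smul]

/-- Covariances as expectations in a doubled system. -/
theorem trace_kronecker_mul_antidoubled (E O₁ O₂ : Matrix n n ℂ) :
    ((E ⊗ₖ E) * (antidoubled O₁ * antidoubled O₂)).trace =
      2 * ((E * (O₁ * O₂)).trace * E.trace - (E * O₁).trace * (E * O₂).trace) := by
  simp only [antidoubled, sub_mul, mul_sub, ← mul_kronecker_mul, trace_sub, trace_kronecker, mul_one, one_mul]
  ring

theorem differentiable_trace_exp_smul_mul (A N : Matrix n n ℂ) :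
    Differentiable ℂ fun t : ℂ => (NormedSpace.exp (t • A) * N).trace := by
  let T : Matrix n n ℂ →L[ℂ] ℂ := LinearMap.toContinuousLinearMap
    ((traceLinearMap n ℂ ℂ).comp (LinearMap.mulRight ℂ N))
  exact fun t => T.differentiableAt.comp t (hasDerivAt_exp_smul_const A t).differentiableAt

end Matrix

/-! ### Vanishing of the covariance to high order at infinite temperature -/

namespace QuantumLattice

open Matrix

variable {D d κ R : ℕ} {h : ℝ} {Λ : Finset (Site D)} {A A₁ A₂ B : Finset Λ}
  {O O₁ O₂ : Operator Λ d}

theorem siteDist_triangle (x y z : Site D) : siteDist x z ≤ siteDist x y + siteDist y z := by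
  rw [siteDist, siteDist, siteDist, ← Finset.sum_add_distrib]
  refine Finset.sum_le_sum fun i _ => ?_
  omega

theorem siteDist_self (x : Site D) : siteDist x x = 0 := by simp [siteDist]

theorem siteDist_le_regionDiam {X : Finset Λ} {x y : Λ} (hx : x ∈ X) (hy : y ∈ X) :
    siteDist (x : Site D) y ≤ regionDiam X :=
  Finset.le_sup (f := fun p : Λ × Λ => siteDist (p.1 : Site D) (p.2 : Site D))
    (Finset.mk_mem_product hx hy)

theorem regionDist_le {x y : Λ} (hx : x ∈ A) (hy : y ∈ B) :
    regionDist A B ≤ siteDist (x : Site D) y :=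
  Nat.sInf_le ⟨x, hx, y, hy, rfl⟩

/-- Few regions of small diameter do not connect two distant regions. -/
theorem exists_separating_region (A₂ : Finset Λ) (n : ℕ) : ∀ (L : List (Finset Λ))
    (A₁ : Finset Λ), L.length = n → (∀ X ∈ L, regionDiam X ≤ R) →
    (∀ x ∈ A₁, ∀ y ∈ A₂, n * (R + 1) < siteDist (x : Site D) y) →
    ∃ B, A₁ ⊆ B ∧ Disjoint A₂ B ∧ ∀ X ∈ L, X ⊆ B ∨ Disjoint X B := by
  induction n with
  | zero =>
    intro L A₁ hL _ hd
    rw [List.length_eq_zero_iff] at hL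
    subst hL
    refine ⟨A₁, subset_rfl, Finset.disjoint_left.2 fun y hy hy1 => ?_, by simp⟩
    have := hd y hy1 y hy
    rw [siteDist_self] at this
    omega
  | succ n ih =>
    intro L A₁ hL hR hd
    -- A region meeting A₁ is absorbed into it: this uses up one list entry and brings A₂ closer by
    -- at most R. If none meets A₁, then B = A₁ works.
    by_cases hX : ∃ X ∈ L, ¬ Disjoint X A₁
    · obtain ⟨X, hXL, hXA⟩ := hX
      obtain ⟨x₀, hx₀, hx₀A⟩ := Finset.not_disjoint_iff.1 hXA
      obtain ⟨B, hB, hB2, hB3⟩ := ih (L.erase X) (A₁ ∪ X)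
        (by rw [List.length_erase_of_mem hXL, hL]; rfl)
        (fun Y hY => hR Y (List.mem_of_mem_erase hY)) (fun x hx y hy => by
          rcases Finset.mem_union.1 hx with hx | hx
          · have := hd x hx y hy
            nlinarith
          · have h1 := hd x₀ hx₀A y hy
            have h2 := siteDist_triangle (x₀ : Site D) x y
            have h3 := (siteDist_le_regionDiam hx₀ hx).trans (hR X hXL)
            nlinarith)
      refine ⟨B, (Finset.subset_union_left).trans hB, hB2, fun Y hY => ?_⟩
      by_cases hYX : Y = X
      · exact Or.inl (hYX ▸ (Finset.subset_union_right).trans hB)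
      · exact hB3 Y ((List.mem_erase_of_ne hYX).2 hY)
    · push Not at hX
      refine ⟨A₁, subset_rfl, Finset.disjoint_left.2 fun y hy hy1 => ?_,
        fun X hXL => Or.inr (hX X hXL)⟩
      have := hd y hy1 y hy
      rw [siteDist_self] at this
      omega

theorem SupportedOn.exchange_doubled (hO : SupportedOn A O) (h : A ⊆ B ∨ Disjoint A B) :
    (doubled O).submatrix (exchange B) (exchange B) = doubled O := by
  rw [doubled, submatrix_add, Pi.add_apply, Pi.add_apply]
  rcases h with h | h
  · rw [hO.exchange_kronecker_one_of_subset h, hO.exchange_one_kronecker_of_subset h, add_comm]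
  · rw [hO.exchange_kronecker_one_of_disjoint h, hO.exchange_one_kronecker_of_disjoint h]

theorem SupportedOn.exchange_antidoubled_of_subset (hO : SupportedOn A O) (h : A ⊆ B) :
    (antidoubled O).submatrix (exchange B) (exchange B) = -antidoubled O := by
  rw [antidoubled, submatrix_sub, Pi.sub_apply, Pi.sub_apply,
    hO.exchange_kronecker_one_of_subset h, hO.exchange_one_kronecker_of_subset h, neg_sub]

theorem SupportedOn.exchange_antidoubled_of_disjoint (hO : SupportedOn A O) (h : Disjoint A B) :
    (antidoubled O).submatrix (exchange B) (exchange B) = antidoubled O := by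
  rw [antidoubled, submatrix_sub, Pi.sub_apply, Pi.sub_apply,
    hO.exchange_kronecker_one_of_disjoint h, hO.exchange_one_kronecker_of_disjoint h]

namespace LocalHamiltonian

theorem weighted_const (H : LocalHamiltonian Λ d κ R h) (t : ℂ) :
    H.weighted (fun _ => t) = t • ∑ X, H.term X := by
  rw [weighted, Finset.smul_sum]

/-- Exchanging the copies on a separating region B preserves the trace, every doubled term and the
second antidoubled factor, but flips the sign of the first. The trace therefore equals its own
negative. -/
theorem trace_prod_mul_antidoubled_eq_zero (H : LocalHamiltonian Λ d κ R h)
    (hO₁ : SupportedOn A₁ O₁) (hO₂ : SupportedOn A₂ O₂) (L : List (Finset Λ))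
    (hd : ∀ x ∈ A₁, ∀ y ∈ A₂, L.length * (R + 1) < siteDist (x : Site D) y) :
    ((L.map fun X => doubled (H.term X)).prod * (antidoubled O₁ * antidoubled O₂)).trace = 0 := by
  by_cases hR : ∀ X ∈ L, regionDiam X ≤ R
  · obtain ⟨B, hB1, hB2, hB3⟩ := exists_separating_region A₂ L.length L A₁ rfl hR hd
    have hW : ((L.map fun X => doubled (H.term X)).prod).submatrix (exchange B) (exchange B) =
        (L.map fun X => doubled (H.term X)).prod := by
      clear hd hR
      induction L with
      | nil => simp [submatrix_one_equiv]
      | cons X L ih =>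
        rw [List.map_cons, List.prod_cons, ← submatrix_mul_equiv _ _ _ (exchange B),
          ih fun Y hY => hB3 Y (List.mem_cons_of_mem _ hY),
          (H.supportedOn X).exchange_doubled (hB3 X List.mem_cons_self)]
    have := trace_submatrix_equiv (exchange B)
      ((L.map fun X => doubled (H.term X)).prod * (antidoubled O₁ * antidoubled O₂))
    rw [← submatrix_mul_equiv _ _ _ (exchange B), ← submatrix_mul_equiv _ _ _ (exchange B), hW,
      hO₁.exchange_antidoubled_of_subset hB1, hO₂.exchange_antidoubled_of_disjoint hB2, neg_mul,
      mul_neg, trace_neg] at this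
    exact self_eq_neg.1 this.symm
  · push Not at hR
    obtain ⟨X, hX, hXR⟩ := hR
    rw [List.prod_eq_zero, zero_mul, trace_zero]
    refine List.mem_map.2 ⟨X, hX, ?_⟩
    rw [H.eq_zero X (Or.inl hXR)]
    simp [doubled]

/-- The power is expanded one factor at a time; `L` collects the terms already chosen, and m + |L|
is the quantity that the induction preserves. -/
theorem trace_pow_mul_antidoubled_eq_zero (H : LocalHamiltonian Λ d κ R h)
    (hO₁ : SupportedOn A₁ O₁) (hO₂ : SupportedOn A₂ O₂) (m : ℕ) : ∀ L : List (Finset Λ),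
    (∀ x ∈ A₁, ∀ y ∈ A₂, (m + L.length) * (R + 1) < siteDist (x : Site D) y) →
    (doubled (∑ X, H.term X) ^ m * ((L.map fun X => doubled (H.term X)).prod *
      (antidoubled O₁ * antidoubled O₂))).trace = 0 := by
  induction m with
  | zero =>
    intro L hd
    rw [pow_zero, one_mul]
    exact H.trace_prod_mul_antidoubled_eq_zero hO₁ hO₂ L (by simpa using hd)
  | succ m ih =>
    intro L hd
    rw [pow_succ, mul_assoc]
    nth_rewrite 2 [doubled_sum]
    rw [Finset.sum_mul, Finset.mul_sum, trace_sum]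
    refine Finset.sum_eq_zero fun X _ => ?_
    have := ih (X :: L) (by simpa [add_assoc, add_comm] using hd)
    rwa [List.map_cons, List.prod_cons, mul_assoc] at this

/-- The connected correlation vanishes to an order given by the distance at infinite
temperature. -/
theorem covariance_isBigO (H : LocalHamiltonian Λ d κ R h)
    (hO₁ : SupportedOn A₁ O₁) (hO₂ : SupportedOn A₂ O₂) (k : ℕ)
    (hd : ∀ j < k, ∀ x ∈ A₁, ∀ y ∈ A₂, j * (R + 1) < siteDist (x : Site D) y) :
    (fun t : ℂ =>
      (NormedSpace.exp (t • ∑ X, H.term X) * (O₁ * O₂)).trace *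
          (NormedSpace.exp (t • ∑ X, H.term X)).trace -
        (NormedSpace.exp (t • ∑ X, H.term X) * O₁).trace *
          (NormedSpace.exp (t • ∑ X, H.term X) * O₂).trace) =O[𝓝 0] fun t => t ^ k := by
  have := trace_exp_mul_isBigO (doubled (∑ X, H.term X)) (antidoubled O₁ * antidoubled O₂) k
    fun j hj => by
      simpa using H.trace_pow_mul_antidoubled_eq_zero hO₁ hO₂ j [] (by simpa using hd j hj)
  simp only [exp_smul_doubled, trace_kronecker_mul_antidoubled] at this
  exact (isBigO_const_mul_left_iff two_ne_zero).1 this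

/-- Nonvanishing is invariant under positive scaling, so the normalization ‖N‖ = 1 can be dropped;
only constant tuples z are needed. -/
theorem AnalyticAfterMeasurement.trace_ne_zero {H : LocalHamiltonian Λ d κ R h} {K : ℕ}
    {δ c β : ℝ} (hH : H.AnalyticAfterMeasurement K δ c β) (hA : A.card ≤ K)
    (hO : SupportedOn A O) (hO' : O.PosSemidef) (hO0 : O ≠ 0) {t : ℂ} (ht : ‖t - β‖ ≤ δ) :
    (NormedSpace.exp ((-t) • ∑ X, H.term X) * O).trace ≠ 0 := by
  have hn : ‖O‖ ≠ 0 := norm_ne_zero_iff.2 hO0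
  have h1 := (hH A (((‖O‖⁻¹ : ℝ) : ℂ) • O) hA (hO.smul _)
    (hO'.smul (by rw [Complex.zero_le_real]; positivity))
    (by rw [norm_smul, Complex.norm_real, norm_inv, norm_norm, inv_mul_cancel₀ hn])
    (fun _ => t) (fun _ => ht)).1
  rw [weighted_const, ← neg_smul, mul_smul_comm, trace_smul] at h1
  exact right_ne_zero_of_smul h1

end LocalHamiltonian

/-! ### Bounds on normalized expectations independent of the system size -/

/-- If no positive semidefinite operator on at most `K` sites has vanishing expectation in the
weights `e^{ψ(w) T}`, `|w| < 1`, then normalized expectations are bounded independently of the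
number of sites. -/
theorem norm_trace_div_le_of_isHermitian [Nonempty (Λ → Fin d)] {T : Operator Λ d} {K : ℕ}
    {ψ : ℂ → ℂ} (hψ : DifferentiableOn ℂ ψ (ball 0 1)) (hψ0 : ψ 0 = 0)
    (hne : ∀ w ∈ ball (0 : ℂ) 1, ∀ (A : Finset Λ) (N : Operator Λ d), A.card ≤ K →
      SupportedOn A N → N.PosSemidef → N ≠ 0 → (NormedSpace.exp (ψ w • T) * N).trace ≠ 0)
    (hA : A.card ≤ K) (hO : SupportedOn A O) (hO' : O.IsHermitian) (hO1 : ‖O‖ ≤ 1)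
    {w : ℂ} (hw : w ∈ ball (0 : ℂ) 1) :
    ‖(NormedSpace.exp (ψ w • T) * O).trace / (NormedSpace.exp (ψ w • T)).trace‖ ≤
      2 + 3 * ((1 + ‖w‖) / (1 - ‖w‖)) ^ 2 := by
  have hZ : ∀ w ∈ ball (0 : ℂ) 1, (NormedSpace.exp (ψ w • T)).trace ≠ 0 := fun w hw => by
    simpa using hne w hw A 1 hA supportedOn_one PosSemidef.one one_ne_zero
  set f : ℂ → ℂ := fun w =>
    2 + (NormedSpace.exp (ψ w • T) * O).trace / (NormedSpace.exp (ψ w • T)).trace with hf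
  have hfd : DifferentiableOn ℂ f (ball 0 1) := by
    refine DifferentiableOn.const_add _ (DifferentiableOn.div ?_ ?_ hZ)
    · exact (differentiable_trace_exp_smul_mul T O).comp_differentiableOn hψ
    · simpa [Function.comp_def] using
        (differentiable_trace_exp_smul_mul T 1).comp_differentiableOn hψ
  have hfs : ∀ w ∈ ball (0 : ℂ) 1, f w ∈ Complex.slitPlane := by
    intro w hw
    by_contra hs
    rw [Complex.mem_slitPlane_iff, not_or, not_lt, not_not] at hs
    -- If f(w) = -s with s ≥ 0, then (2 + s)·1 + O is positive semidefinite with vanishing trace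
    -- against the weight. The shift by 2 rather than 1 makes this operator nonzero even if s = 0
    -- and O = -1.
    set s : ℝ := -(f w).re with hsdef
    have hs0 : 0 ≤ s := by linarith [hs.1]
    have hfw : f w = -(s : ℂ) := by
      apply Complex.ext <;> simp [hsdef, hs.2]
    have hN := hO'.posSemidef_smul_one_add hO1 (c := 2 + s) (by linarith)
    refine hne w hw A _ hA ((supportedOn_one.smul _).add hO) hN ?_ ?_
    · intro h0
      have h1 : O = -(((2 + s : ℝ) : ℂ) • 1) := (neg_eq_of_add_eq_zero_right h0).symm
      rw [h1, norm_neg, norm_smul, norm_one, Complex.norm_real, Real.norm_of_nonneg (by linarith)]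
        at hO1
      linarith
    · rw [mul_add, trace_add, mul_smul_comm, mul_one, trace_smul, smul_eq_mul]
      have h1 : (NormedSpace.exp (ψ w • T) * O).trace =
          (f w - 2) * (NormedSpace.exp (ψ w • T)).trace := by
        rw [hf]; field_simp [hZ w hw]; ring
      rw [h1, hfw]
      push_cast
      ring
  have h0 : ‖f 0‖ ≤ 3 := by
    have hc : (0 : ℝ) < Fintype.card (Λ → Fin d) := by exact_mod_cast Fintype.card_pos
    have h1 : ‖O.trace / (Fintype.card (Λ → Fin d) : ℂ)‖ ≤ 1 := by
      rw [norm_div, Complex.norm_natCast, div_le_one hc]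
      exact norm_trace_le hO' hO1
    have h2 : f 0 = 2 + O.trace / (Fintype.card (Λ → Fin d) : ℂ) := by
      simp only [hf, hψ0, zero_smul, NormedSpace.exp_zero, one_mul, trace_one]
    rw [h2]
    refine (norm_add_le _ _).trans ?_
    rw [Complex.norm_ofNat]
    linarith
  have h1 := norm_le_of_mem_slitPlane hfd hfs hw
  have h2 : (NormedSpace.exp (ψ w • T) * O).trace / (NormedSpace.exp (ψ w • T)).trace =
      f w - 2 := by rw [hf]; ring
  have h3 : ‖f w‖ ≤ 3 * ((1 + ‖w‖) / (1 - ‖w‖)) ^ 2 :=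
    h1.trans (mul_le_mul_of_nonneg_right h0 (sq_nonneg _))
  rw [h2]
  refine (norm_sub_le _ _).trans ?_
  rw [Complex.norm_ofNat]
  linarith

/-- The product O₁O₂ need not be Hermitian, so the bound is extended through real and imaginary
parts, at the cost of a factor 2. -/
theorem norm_trace_div_le [Nonempty (Λ → Fin d)] {T : Operator Λ d} {K : ℕ}
    {ψ : ℂ → ℂ} (hψ : DifferentiableOn ℂ ψ (ball 0 1)) (hψ0 : ψ 0 = 0)
    (hne : ∀ w ∈ ball (0 : ℂ) 1, ∀ (A : Finset Λ) (N : Operator Λ d), A.card ≤ K →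
      SupportedOn A N → N.PosSemidef → N ≠ 0 → (NormedSpace.exp (ψ w • T) * N).trace ≠ 0)
    (hA : A.card ≤ K) (hO : SupportedOn A O) {w : ℂ} (hw : w ∈ ball (0 : ℂ) 1) :
    ‖(NormedSpace.exp (ψ w • T) * O).trace / (NormedSpace.exp (ψ w • T)).trace‖ ≤
      2 * (2 + 3 * ((1 + ‖w‖) / (1 - ‖w‖)) ^ 2) * ‖O‖ := by
  set b : ℝ := 2 + 3 * ((1 + ‖w‖) / (1 - ‖w‖)) ^ 2 with hb
  have hb0 : 0 ≤ b := by positivity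
  have herm : ∀ M : Operator Λ d, SupportedOn A M → M.IsHermitian →
      ‖(NormedSpace.exp (ψ w • T) * M).trace / (NormedSpace.exp (ψ w • T)).trace‖ ≤ b * ‖M‖ := by
    intro M hM hM'
    by_cases hM0 : M = 0
    · simp [hM0]
    have hn : ‖M‖ ≠ 0 := norm_ne_zero_iff.2 hM0
    have := norm_trace_div_le_of_isHermitian hψ hψ0 hne hA (hM.smul ((‖M‖⁻¹ : ℝ) : ℂ))
      (by
        rw [IsHermitian, conjTranspose_smul, hM'.eq]
        simp)
      (by rw [norm_smul, Complex.norm_real, norm_inv, norm_norm, inv_mul_cancel₀ hn]) hw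
    rw [mul_smul_comm, trace_smul, smul_eq_mul, mul_div_assoc, norm_mul, Complex.norm_real,
      norm_inv, norm_norm, inv_mul_le_iff₀ (by positivity)] at this
    linarith
  have hre := herm (O + Oᴴ) (hO.add hO.conjTranspose) (isHermitian_add_transpose_self O)
  have him := herm (Complex.I • (O + (-1 : ℂ) • Oᴴ))
    ((hO.add (hO.conjTranspose.smul _)).smul _) (by
      rw [IsHermitian]
      simp [conjTranspose_smul, conjTranspose_add]
      abel)
  have hn : ‖Oᴴ‖ = ‖O‖ := l2_opNorm_conjTranspose O
  have hn1 : ‖O + Oᴴ‖ ≤ 2 * ‖O‖ := (norm_add_le _ _).trans (by rw [hn, two_mul])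
  have hn2 : ‖Complex.I • (O + (-1 : ℂ) • Oᴴ)‖ ≤ 2 * ‖O‖ := by
    rw [norm_smul, Complex.norm_I, one_mul]
    refine (norm_add_le _ _).trans ?_
    rw [norm_smul, norm_neg, norm_one, one_mul, hn, two_mul]
  set Z := (NormedSpace.exp (ψ w • T)).trace
  have hsum : (NormedSpace.exp (ψ w • T) * O).trace / Z =
      (1 / 2 : ℂ) * ((NormedSpace.exp (ψ w • T) * (O + Oᴴ)).trace / Z) -
      (Complex.I / 2) *
        ((NormedSpace.exp (ψ w • T) * (Complex.I • (O + (-1 : ℂ) • Oᴴ))).trace / Z) := by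
    simp only [mul_add, mul_smul_comm, trace_add, trace_smul, smul_eq_mul]
    ring_nf
    rw [Complex.I_sq]
    ring
  rw [hsum]
  refine (norm_sub_le _ _).trans ?_
  rw [norm_mul, norm_mul]
  have e1 : ‖(1 / 2 : ℂ)‖ = 1 / 2 := by simp
  have e2 : ‖(Complex.I / 2 : ℂ)‖ = 1 / 2 := by simp
  rw [e1, e2]
  have h1 := mul_le_mul_of_nonneg_left hn1 hb0
  have h2 := mul_le_mul_of_nonneg_left hn2 hb0
  linarith

end QuantumLattice

/-! ### Assembly: exponential decay -/

theorem norm_sub_mul_le_add_mul {x y z : ℂ} {a b c : ℝ} (hx : ‖x‖ ≤ a) (hy : ‖y‖ ≤ b) (hz : ‖z‖ ≤ c) :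
    ‖x - y * z‖ ≤ a + b * c := by
  refine (norm_sub_le _ _).trans (add_le_add hx ?_)
  rw [norm_mul]
  exact mul_le_mul hy hz (norm_nonneg _) ((norm_nonneg _).trans hy)

theorem mainTheorem5 (D d κ R K : ℕ) (h δ βc : ℝ) (c : ℝ → ℝ) (hδ : 0 < δ)
    (β : ℝ) (hβ : β ∈ Set.Ico 0 βc) :
    ∃ C ξ : ℝ, 0 < C ∧ 0 < ξ ∧
      ∀ (Λ : Finset (QuantumLattice.Site D))
        (H : QuantumLattice.LocalHamiltonian Λ d κ R h),
        H.MutuallyCommuting →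
        (∀ β' ∈ Set.Ico 0 βc, H.AnalyticAfterMeasurement K δ (c β') β') →
        H.ExponentialDecay K C ξ β := by
  obtain ⟨ψ, w₀, hw0, hw1, hψ0, hψw, hψ, hψδ⟩ := exists_disc_map hβ.1 hδ
  -- The bound on expectations blows up at the unit circle, so an intermediate radius w₀ < ρ < 1 is
  -- used.
  set ρ : ℝ := (1 + w₀) / 2 with hρ
  have hρ0 : 0 < ρ := by linarith
  have hwρ : w₀ < ρ := by linarith
  have hρ1 : ρ < 1 := by linarith
  set b : ℝ := 2 * (2 + 3 * ((1 + ρ) / (1 - ρ)) ^ 2) with hb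
  have hb0 : 0 < b := by positivity
  have hlog : 0 < Real.log (ρ / w₀) := Real.log_pos ((one_lt_div hw0).2 hwρ)
  -- The term b bounds ⟨O₁O₂⟩ and b·b bounds ⟨O₁⟩⟨O₂⟩; ξ is chosen so that (w₀/ρ)^(dist/(R+1)) =
  -- e^{-dist/ξ}.
  refine ⟨b + b * b, (R + 1) / Real.log (ρ / w₀), by positivity, by positivity, ?_⟩
  intro Λ H _ hH A₁ A₂ O₁ O₂ hK hO₁ hO₂ _ _
  -- With d = 0 and at least one site there are no configurations, and all operators are zero.
  rcases isEmpty_or_nonempty (Λ → Fin d) with hemp | hnonemp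
  · rw [Subsingleton.elim O₁ 0, Subsingleton.elim O₂ 0]
    simp
  set T : QuantumLattice.Operator Λ d := ∑ X, H.term X with hT
  have hne : ∀ w ∈ ball (0 : ℂ) 1, ∀ (A : Finset Λ) (N : QuantumLattice.Operator Λ d),
      A.card ≤ K → QuantumLattice.SupportedOn A N → N.PosSemidef → N ≠ 0 →
      (NormedSpace.exp ((-ψ w) • T) * N).trace ≠ 0 := by
    intro w hw A N hA hN hN' hN0
    obtain ⟨β', hβ', hd⟩ := hψδ w hw
    exact (hH β' ⟨hβ'.1, hβ'.2.trans_lt hβ.2⟩).trace_ne_zero hA hN hN' hN0 hd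
  have hψn0 : -ψ 0 = 0 := by rw [hψ0, neg_zero]
  set E : ℂ → QuantumLattice.Operator Λ d := fun w => NormedSpace.exp ((-ψ w) • T) with hE
  have hZ : ∀ w ∈ ball (0 : ℂ) 1, (E w).trace ≠ 0 := fun w hw => by
    have := hne w hw ∅ 1 (by simp) QuantumLattice.supportedOn_one Matrix.PosSemidef.one
      one_ne_zero
    rwa [mul_one] at this
  have hbound : ∀ w ∈ ball (0 : ℂ) ρ, ∀ (A : Finset Λ) (M : QuantumLattice.Operator Λ d),
      A.card ≤ K → QuantumLattice.SupportedOn A M →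
      ‖(E w * M).trace / (E w).trace‖ ≤ b * ‖M‖ := by
    intro w hw A M hA hM
    have hw : ‖w‖ < ρ := by simpa using hw
    refine (QuantumLattice.norm_trace_div_le (ψ := fun w => -ψ w) hψ.neg hψn0 hne hA hM
      (w := w) (by simpa using hw.trans hρ1)).trans ?_
    rw [hb]
    have : 0 < 1 - ρ := by linarith
    have : 0 ≤ (1 + ‖w‖) / (1 - ‖w‖) := div_nonneg (by positivity) (by linarith)
    gcongr
  have hdiff : ∀ M : QuantumLattice.Operator Λ d,
      DifferentiableOn ℂ (fun w => (E w * M).trace) (ball 0 1) := fun M =>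
    (Matrix.differentiable_trace_exp_smul_mul T M).comp_differentiableOn hψ.neg
  have hdiffZ : DifferentiableOn ℂ (fun w => (E w).trace) (ball 0 1) := by
    simpa using hdiff 1
  set F : ℂ → ℂ := fun w => (E w * (O₁ * O₂)).trace / (E w).trace -
    (E w * O₁).trace / (E w).trace * ((E w * O₂).trace / (E w).trace) with hF
  have hFd : DifferentiableOn ℂ F (ball 0 ρ) := by
    refine DifferentiableOn.mono ?_ (ball_subset_ball hρ1.le)
    exact ((hdiff _).div hdiffZ hZ).sub
      (((hdiff _).div hdiffZ hZ).mul ((hdiff _).div hdiffZ hZ))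
  have hFb : ∀ w ∈ ball (0 : ℂ) ρ, ‖F w‖ ≤ (b + b * b) * ‖O₁‖ * ‖O₂‖ := by
    intro w hw
    have h12 := hbound w hw (A₁ ∪ A₂) (O₁ * O₂) ((Finset.card_union_le _ _).trans hK)
      ((hO₁.mono Finset.subset_union_left).mul (hO₂.mono Finset.subset_union_right))
    have h1 := hbound w hw A₁ O₁ (by omega) hO₁
    have h2 := hbound w hw A₂ O₂ (by omega) hO₂
    have h3 : b * ‖O₁ * O₂‖ ≤ b * (‖O₁‖ * ‖O₂‖) :=
      mul_le_mul_of_nonneg_left (Matrix.l2_opNorm_mul O₁ O₂) hb0.le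
    exact (norm_sub_mul_le_add_mul (h12.trans h3) h1 h2).trans_eq (by ring)
  -- The ceiling of dist/(R+1): every j < k satisfies the strict separation condition, while k(R+1)
  -- ≥ dist. If A₁ or A₂ is empty, the distance and k are 0.
  set k : ℕ := (QuantumLattice.regionDist A₁ A₂ + R) / (R + 1) with hk
  have hkd : ∀ j < k, j * (R + 1) < QuantumLattice.regionDist A₁ A₂ := by
    intro j hj
    have h1 : (j + 1) * (R + 1) ≤ QuantumLattice.regionDist A₁ A₂ + R :=
      (Nat.le_div_iff_mul_le (Nat.succ_pos R)).1 hj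
    rw [add_mul] at h1
    omega
  have hkr : (QuantumLattice.regionDist A₁ A₂ : ℝ) ≤ k * (R + 1) := by
    have h1 : QuantumLattice.regionDist A₁ A₂ + R < (k + 1) * (R + 1) :=
      (Nat.div_lt_iff_lt_mul (Nat.succ_pos R)).1 (Nat.lt_succ_self _)
    rw [add_mul] at h1
    have h2 : QuantumLattice.regionDist A₁ A₂ ≤ k * (R + 1) := by omega
    exact_mod_cast h2
  have hmem : ball (0 : ℂ) 1 ∈ 𝓝 (0 : ℂ) := ball_mem_nhds 0 one_pos
  have hψO : (fun w => -ψ w) =O[𝓝 0] fun w : ℂ => w := by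
    simpa [hψ0] using (hψ.neg.differentiableAt hmem).isBigO_sub
  have hψt : Tendsto (fun w => -ψ w) (𝓝 0) (𝓝 0) := by
    have := (hψ.differentiableAt hmem).continuousAt.tendsto.neg
    rwa [hψn0] at this
  have hFO : F =O[𝓝[≠] 0] fun w => w ^ k := by
    have h1 := (H.covariance_isBigO hO₁ hO₂ k fun j hj x hx y hy =>
      (hkd j hj).trans_le (QuantumLattice.regionDist_le hx hy)).comp_tendsto hψt
    have h2 := h1.trans (hψO.pow k)
    -- F is the unnormalized covariance divided by the squared partition function, which is nonzero
    -- at 0, so the division preserves the order of vanishing.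
    have h3 : (fun w => ((E w).trace ^ 2)⁻¹) =O[𝓝 0] fun _ : ℂ => (1 : ℂ) := by
      refine Tendsto.isBigO_one (c := ((E 0).trace ^ 2)⁻¹) ℂ ?_
      refine Tendsto.inv₀ ?_ (pow_ne_zero _ (hZ 0 (by simp)))
      exact ((hdiffZ.differentiableAt hmem).continuousAt.tendsto).pow 2
    have h4 := (h3.mul h2).mono (nhdsWithin_le_nhds (s := {0}ᶜ))
    simp only [one_mul] at h4
    refine h4.congr' ?_ EventuallyEq.rfl
    filter_upwards [nhdsWithin_le_nhds hmem] with w hw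
    have := hZ w hw
    simp only [hF, Function.comp, ← hT]
    simp only [hE] at this ⊢
    field_simp
  have key := norm_le_mul_pow_of_isBigO hρ0 k hFd hFb hFO (w₀ : ℂ)
    (by simpa [abs_of_pos hw0] using hwρ)
  rw [Complex.norm_real, Real.norm_of_nonneg hw0.le] at key
  have hexp : (w₀ / ρ) ^ k ≤ Real.exp (-(QuantumLattice.regionDist A₁ A₂ : ℝ) /
      ((R + 1) / Real.log (ρ / w₀))) := by
    have h1 : w₀ / ρ = Real.exp (-Real.log (ρ / w₀)) := by
      rw [← Real.log_inv, inv_div, Real.exp_log (by positivity)]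
    rw [h1, ← Real.exp_nat_mul, Real.exp_le_exp, div_div_eq_mul_div,
      le_div_iff₀ (by positivity)]
    nlinarith
  have hg : ∀ M, (H.gibbs β * M).trace = (E w₀ * M).trace / (E w₀).trace := by
    intro M
    simp only [QuantumLattice.LocalHamiltonian.gibbs, hE, hψw]
    rw [QuantumLattice.LocalHamiltonian.weighted_const, ← neg_smul, smul_mul_assoc,
      Matrix.trace_smul, smul_eq_mul, div_eq_inv_mul]
  rw [mul_assoc, hg, hg, hg]
  exact key.trans (mul_le_mul_of_nonneg_left hexp (by positivity))
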